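/- Let $\Omega\subset\mathbb{R}^2$ be a nonempty bounded open set (for instance a bounded simply connected domain), let $\mathbb{K}\in\{\mathbb{R},\mathbb{C}\}$, and let $n_s,n_b$ be real numbers with $n_s>1$. All functions are $\mathbb{K}$-valued, $(f,g)=\int_\Omega f\,\overline{g}\,dx$ is the inner product of $L^2(\Omega)$, and $\|\cdot\|_{0}$ its norm. Let $H^2_0(\Omega)$ be the closure of $C_c^\infty(\Omega)$ in $H^2(\Omega)$, and let $U=H^2_0(\Omega)\times L^2(\Omega)\times L^2(\Omega)$ with $\|(u,y,p)\|_U^2=\|u\|_{H^2(\Omega)}^2+\|y\|_{0}^2+\|p\|_{0}^2$. For a measurable real function $n$ with $n_s\le n(x)\le n_b$ for almost every $x\in\Omega$, put $\alpha=\frac{1}{n-1}$ and, for $(u,y,p),(v,z,q)\in U$, $$a_{U,\alpha}((u,y,p),(v,z,q))=(\alpha\Delta u,\Delta v)+(\alpha y,\Delta v)+(\alpha\Delta u,z)+((1+\alpha)y,z)-(p,z)-(y,q).$$ Then there are constants $M,C>0$, depending only on $\Omega,n_s,n_b$ (and on the choice of $\mathbb{K}$), such that for every such $n$: 1. $a_{U,\alpha}$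 is a continuous sesquilinear form on $U$ (a continuous bilinear form if $\mathbb{K}=\mathbb{R}$), and $|a_{U,\alpha}(w,w')|\le M\|w\|_U\|w'\|_U$ for all $w,w'\in U$; 2. the inf-sup condition holds: $$\inf_{0\ne(v,z,q)\in U}\ \sup_{0\ne(u,y,p)\in U}\frac{\operatorname{Re}a_{U,\alpha}((u,y,p),(v,z,q))}{\|(u,y,p)\|_U\,\|(v,z,q)\|_U}\ \ge\ C;$$ 3. for all $u\in H^2_0(\Omega)$ and $y\in L^2(\Omega)$, $$(\alpha\Delta u,\Delta u)+2\operatorname{Re}(\alpha\Delta u,y)+((1+\alpha)y,y)\ \ge\ \frac{1}{n_b-1}\Bigl(1-\sqrt{\tfrac{1}{n_s}}\Bigr)\bigl(\|y\|_{0}^2+\|\Delta u\|_{0}^2\bigr).$$ Moreover, $$\inf_{0\ne q\in L^2(\Omega)}\ \sup_{0\ne y\in L^2(\Omega)}\frac{\operatorname{Re}(y,q)}{\|y\|_{0}\,\|q\|_{0}}=1 .$$ (If $\mathbb{K}=\mathbb{R}$, the symbols $\operatorname{Re}$ and the complex conjugation can be omitted.) -/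

import Mathlib

open MeasureTheory TopologicalSpace
open scoped Distributions LineDeriv ENNReal ComplexConjugate

noncomputable section

namespace TransmissionEigenvalue

/-- The plane `ℝ²`, with its Euclidean norm and Lebesgue measure. -/
abbrev Plane : Type := EuclideanSpace ℝ (Fin 2)

/-- The `i`-th coordinate direction of the plane. -/
def coordVec (i : Fin 2) : Plane := EuclideanSpace.single i 1

/-- The space `L²(Ω)` of `𝕜`-valued functions, where `𝕜` is `ℝ` or `ℂ`. -/
abbrev L2 (𝕜 : Type*) [RCLike 𝕜] (Ω : Opens Plane) : Type _ :=
  Lp 𝕜 2 ((volume : Measure Plane).restrict (Ω : Set Plane))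

/-- `g` is the weak partial derivative `∂ᵢ u` on `Ω`: for all smooth `φ` with compact support
in `Ω` one has `∫_Ω (∂ᵢ φ) u = - ∫_Ω φ g`. -/
def IsWeakPartial {𝕜 : Type*} [RCLike 𝕜] {Ω : Opens Plane} (i : Fin 2) (u g : L2 𝕜 Ω) : Prop :=
  ∀ φ : 𝓓(Ω, ℝ),
    ∫ x in (Ω : Set Plane), (∂_{coordVec i} φ) x • u x =
      -∫ x in (Ω : Set Plane), φ x • g x

lemma integrable_test_smul {𝕜 : Type*} [RCLike 𝕜] {Ω : Opens Plane} (φ : 𝓓(Ω, ℝ))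
    (u : L2 𝕜 Ω) :
    Integrable (fun x => φ x • u x) ((volume : Measure Plane).restrict (Ω : Set Plane)) := by
  have h1 : MemLp φ 2 ((volume : Measure Plane).restrict (Ω : Set Plane)) :=
    φ.continuous.memLp_of_hasCompactSupport φ.hasCompactSupport
  exact (Lp.memLp u).smul h1 |> memLp_one_iff_integrable.1

lemma IsWeakPartial.add {𝕜 : Type*} [RCLike 𝕜] {Ω : Opens Plane} {i : Fin 2}
    {u g v h : L2 𝕜 Ω} (hu : IsWeakPartial i u g) (hv : IsWeakPartial i v h) :
    IsWeakPartial i (u + v) (g + h) := by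
  intro φ
  have e1 : ∫ x in (Ω : Set Plane), (∂_{coordVec i} φ) x • (u + v : L2 𝕜 Ω) x =
      ∫ x in (Ω : Set Plane),
        ((∂_{coordVec i} φ) x • u x + (∂_{coordVec i} φ) x • v x) := by
    apply integral_congr_ae
    filter_upwards [Lp.coeFn_add u v] with x hx
    rw [hx, Pi.add_apply, smul_add]
  have e2 : ∫ x in (Ω : Set Plane), φ x • (g + h : L2 𝕜 Ω) x =
      ∫ x in (Ω : Set Plane), (φ x • g x + φ x • h x) := by
    apply integral_congr_ae
    filter_upwards [Lp.coeFn_add g h] with x hx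
    rw [hx, Pi.add_apply, smul_add]
  rw [e1, e2, integral_add (integrable_test_smul _ u) (integrable_test_smul _ v),
    integral_add (integrable_test_smul _ g) (integrable_test_smul _ h), hu φ, hv φ]
  ring

lemma IsWeakPartial.smul {𝕜 : Type*} [RCLike 𝕜] {Ω : Opens Plane} {i : Fin 2}
    {u g : L2 𝕜 Ω} (c : 𝕜) (hu : IsWeakPartial i u g) :
    IsWeakPartial i (c • u) (c • g) := by
  intro φ
  have e1 : ∫ x in (Ω : Set Plane), (∂_{coordVec i} φ) x • (c • u : L2 𝕜 Ω) x =
      ∫ x in (Ω : Set Plane), c • ((∂_{coordVec i} φ) x • u x) := by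
    apply integral_congr_ae
    filter_upwards [Lp.coeFn_smul c u] with x hx
    rw [hx, Pi.smul_apply, smul_comm]
  have e2 : ∫ x in (Ω : Set Plane), φ x • (c • g : L2 𝕜 Ω) x =
      ∫ x in (Ω : Set Plane), c • (φ x • g x) := by
    apply integral_congr_ae
    filter_upwards [Lp.coeFn_smul c g] with x hx
    rw [hx, Pi.smul_apply, smul_comm]
  rw [e1, e2, integral_smul, integral_smul, hu φ, smul_neg]

lemma IsWeakPartial.zero {𝕜 : Type*} [RCLike 𝕜] {Ω : Opens Plane} {i : Fin 2} :
    IsWeakPartial i (0 : L2 𝕜 Ω) 0 := by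
  intro φ
  have e : ∀ ψ : 𝓓(Ω, ℝ), ∫ x in (Ω : Set Plane), ψ x • (0 : L2 𝕜 Ω) x = 0 := by
    intro ψ
    refine integral_eq_zero_of_ae ?_
    filter_upwards [Lp.coeFn_zero 𝕜 2 ((volume : Measure Plane).restrict (Ω : Set Plane))]
      with x hx
    rw [hx, Pi.zero_apply, smul_zero]
  rw [e, e, neg_zero]

/-- Index set of the components `u`, `∂ᵢ u`, `∂ⱼ ∂ᵢ u` of a function with its derivatives up to
order two. -/
abbrev JetIndex : Type := Unit ⊕ Fin 2 ⊕ (Fin 2 × Fin 2)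

/-- Families of `L²(Ω)` functions indexed by `JetIndex`, with the Hilbert norm
`‖J‖² = ‖J.val‖² + ∑ᵢ ‖J.grad i‖² + ∑ᵢⱼ ‖J.hess i j‖²`. -/
abbrev Jet (𝕜 : Type*) [RCLike 𝕜] (Ω : Opens Plane) : Type _ :=
  PiLp 2 (fun _ : JetIndex => L2 𝕜 Ω)

namespace Jet

variable {𝕜 : Type*} [RCLike 𝕜] {Ω : Opens Plane}

/-- The function itself. -/
def val (J : Jet 𝕜 Ω) : L2 𝕜 Ω := J (Sum.inl ())

/-- The component in the place of `∂ᵢ u`. -/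
def grad (J : Jet 𝕜 Ω) (i : Fin 2) : L2 𝕜 Ω := J (Sum.inr (Sum.inl i))

/-- The component in the place of `∂ⱼ ∂ᵢ u`. -/
def hess (J : Jet 𝕜 Ω) (i j : Fin 2) : L2 𝕜 Ω := J (Sum.inr (Sum.inr (i, j)))

/-- The Laplacian `Δ u = ∂₁∂₁ u + ∂₂∂₂ u`. -/
def laplacian (J : Jet 𝕜 Ω) : L2 𝕜 Ω := J.hess 0 0 + J.hess 1 1

end Jet

/-- The Sobolev space `H²(Ω)`: functions `u ∈ L²(Ω)` that have weak partial derivatives of first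
and second order in `L²(Ω)`. A function is carried along with these derivatives (which it
determines uniquely), so that the norm inherited from `Jet` is the `H²(Ω)` norm. -/
def H2 (𝕜 : Type*) [RCLike 𝕜] (Ω : Opens Plane) : Submodule 𝕜 (Jet 𝕜 Ω) where
  carrier := {J | (∀ i, IsWeakPartial i J.val (J.grad i)) ∧
    ∀ i j, IsWeakPartial j (J.grad i) (J.hess i j)}
  add_mem' := fun hJ hK =>
    ⟨fun i => (hJ.1 i).add (hK.1 i), fun i j => (hJ.2 i j).add (hK.2 i j)⟩
  zero_mem' := ⟨fun _ => IsWeakPartial.zero, fun _ _ => IsWeakPartial.zero⟩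
  smul_mem' := fun c _ hJ => ⟨fun i => (hJ.1 i).smul c, fun i j => (hJ.2 i j).smul c⟩

/-- A smooth function with compact support in `Ω`, as an element of `L²(Ω)`. -/
def testToL2 (𝕜 : Type*) [RCLike 𝕜] (Ω : Opens Plane) : 𝓓(Ω, 𝕜) →ₗ[𝕜] L2 𝕜 Ω where
  toFun φ := (φ.continuous.memLp_of_hasCompactSupport φ.hasCompactSupport :
    MemLp φ 2 ((volume : Measure Plane).restrict (Ω : Set Plane))).toLp φ
  map_add' _ _ := rfl
  map_smul' _ _ := rfl

/-- A smooth function with compact support in `Ω` together with its classical derivatives of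
order at most two. -/
def testJet (𝕜 : Type*) [RCLike 𝕜] (Ω : Opens Plane) : 𝓓(Ω, 𝕜) →ₗ[𝕜] Jet 𝕜 Ω where
  toFun φ := WithLp.toLp 2 (Sum.elim (fun _ => testToL2 𝕜 Ω φ) (Sum.elim
    (fun i => testToL2 𝕜 Ω (∂_{coordVec i} φ))
    (fun ij => testToL2 𝕜 Ω (∂_{coordVec ij.2} (∂_{coordVec ij.1} φ)))))
  map_add' φ ψ := by
    ext1 k
    rcases k with k | k | k <;> simp [LineDeriv.lineDerivOp_add]
  map_smul' c φ := by
    ext1 k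
    rcases k with k | k | k <;> simp [LineDeriv.lineDerivOp_smul]

/-- The space `H²₀(Ω)`: the closure of `C_c^∞(Ω)` in `H²(Ω)`. -/
def H20 (𝕜 : Type*) [RCLike 𝕜] (Ω : Opens Plane) : Submodule 𝕜 (Jet 𝕜 Ω) :=
  H2 𝕜 Ω ⊓ (LinearMap.range (testJet 𝕜 Ω)).topologicalClosure

/-- The product space `U = H²₀(Ω) × L²(Ω) × L²(Ω)` with its Hilbert norm
`‖(u, y, p)‖² = ‖u‖² + ‖y‖² + ‖p‖²`. -/
abbrev U (𝕜 : Type*) [RCLike 𝕜] (Ω : Opens Plane) : Type _ :=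
  WithLp 2 (H20 𝕜 Ω × WithLp 2 (L2 𝕜 Ω × L2 𝕜 Ω))

section Forms

variable {𝕜 : Type*} [RCLike 𝕜] {Ω : Opens Plane}

/-- The component `u` of `(u, y, p) ∈ U`. -/
def U.u (w : U 𝕜 Ω) : H20 𝕜 Ω := w.fst

/-- The component `y` of `(u, y, p) ∈ U`. -/
def U.y (w : U 𝕜 Ω) : L2 𝕜 Ω := w.snd.fst

/-- The component `p` of `(u, y, p) ∈ U`. -/
def U.p (w : U 𝕜 Ω) : L2 𝕜 Ω := w.snd.snd

/-- The Laplacian on `H²₀(Ω)`. -/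
def lap (u : H20 𝕜 Ω) : L2 𝕜 Ω := Jet.laplacian (u : Jet 𝕜 Ω)

/-- The weighted `L²` product `(w f, g) = ∫_Ω w f ḡ`; here `w` is real valued. -/
def wInner (w : Plane → ℝ) (f g : L2 𝕜 Ω) : 𝕜 :=
  ∫ x in (Ω : Set Plane), (w x : 𝕜) * f x * conj (g x)

/-- The `L²` product `(f, g) = ∫_Ω f ḡ`, linear in the first argument. -/
def l2Inner (f g : L2 𝕜 Ω) : 𝕜 := wInner (fun _ => 1) f g

/-- The `(u, y)` block
`(α Δu, Δv) + (α y, Δv) + (α Δu, z) + ((1 + α) y, z)` of the form `a_{U,α}`. -/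
def aBlock (α : Plane → ℝ) (u : H20 𝕜 Ω) (y : L2 𝕜 Ω) (v : H20 𝕜 Ω) (z : L2 𝕜 Ω) : 𝕜 :=
  wInner α (lap u) (lap v) + wInner α y (lap v) + wInner α (lap u) z +
    wInner (fun x => 1 + α x) y z

/-- The form `a_{U,α}((u, y, p), (v, z, q)) =
(α Δu, Δv) + (α y, Δv) + (α Δu, z) + ((1 + α) y, z) - (p, z) - (y, q)`. -/
def aU (α : Plane → ℝ) (w w' : U 𝕜 Ω) : 𝕜 :=
  aBlock α w.u w.y w'.u w'.y - l2Inner w.p w'.y - l2Inner w.y w'.p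

end Forms

/-- The coefficient `α = 1 / (n - 1)`. -/
def alphaOf (n : Plane → ℝ) (x : Plane) : ℝ := 1 / (n x - 1)

/-- The inf-sup number `inf_{y ≠ 0} sup_{x ≠ 0} a(x, y) / (‖x‖ ‖y‖)`, an extended real. -/
def infSup {X Y : Type*} [NormedAddCommGroup X] [NormedAddCommGroup Y] (a : X → Y → ℝ) : EReal :=
  ⨅ y : {y : Y // y ≠ 0}, ⨆ x : {x : X // x ≠ 0},
    ((a x.1 y.1 / (‖x.1‖ * ‖y.1‖) : ℝ) : EReal)

end TransmissionEigenvalue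

end

open TransmissionEigenvalue

/-! Since `1 + α = α n`, the integrand of the `(u, y)` block on the diagonal is `α (|Δu|² + 2 Re(Δu
ȳ) + n |y|²)`. Young's inequality with weight `1/√ns` absorbs the mixed term because `ns > 1`, which
gives coercivity in `(Δu, y)` (`le_re_aBlock_self`). On `H²₀` this controls the full norm
(`norm_sq_le_norm_sq_lap`): integration by parts gives `‖Δf‖ = ‖D²f‖` for test functions, and
Poincaré's inequality on the bounded set `Ω` bounds the lower derivatives.

The block does not see `p`. For the inf-sup condition, `(u, y, p)` is therefore paired with `(u, y -
δ p, -p)`: the sign of `p` cancels the real parts of the two coupling terms, and the shift by `-δ p`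
produces `δ ‖p‖²`. For small `δ` the new cross terms are absorbed by the coercive ones
(`infSup_aU_ge`). -/

open TransmissionEigenvalue

namespace TransmissionEigenvalue

/-! ### Integration by parts and Poincaré's inequality for test functions. -/

section TestFunctions

variable {𝕜 : Type*} [RCLike 𝕜] {Ω : Opens Plane}

lemma testFunction_eq_zero_of_notMem (f : 𝓓(Ω, 𝕜)) {x : Plane} (hx : x ∉ (Ω : Set Plane)) :
    f x = 0 :=
  image_eq_zero_of_notMem_tsupport fun h => hx (f.tsupport_subset h)

lemma lineDerivOp_testFunction_apply (f : 𝓓(Ω, 𝕜)) (v x : Plane) :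
    (∂_{v} f) x = fderiv ℝ f x v := by
  rw [TestFunction.lineDerivOp_eq_lineDerivCLM ℝ, TestFunction.lineDerivCLM_apply,
    if_pos (by simp)]
  exact (f.contDiff.differentiable (by simp) x).lineDeriv_eq_fderiv

lemma lineDerivOp_testFunction_comm (f : 𝓓(Ω, 𝕜)) (v w : Plane) :
    ∂_{v} (∂_{w} f) = ∂_{w} (∂_{v} f) := by
  have h2 : ContDiff ℝ 2 f := contDiff_infty.1 f.contDiff 2
  have key (v w x : Plane) : (∂_{v} (∂_{w} f)) x = fderiv ℝ (fderiv ℝ f) x v w := by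
    rw [lineDerivOp_testFunction_apply]
    have h : ((∂_{w} f : 𝓓(Ω, 𝕜)) : Plane → 𝕜) = fun y => fderiv ℝ f y w :=
      funext fun y => lineDerivOp_testFunction_apply f w y
    rw [h, fderiv_clm_apply ((h2.fderiv_right (m := 1) (by norm_num)).differentiable
      (by simp) x) (by fun_prop)]
    simp
  ext x
  rw [key, key]
  exact (h2.contDiffAt.isSymmSndFDerivAt (by simp)) v w

lemma coeFn_testToL2 (f : 𝓓(Ω, 𝕜)) :
    testToL2 𝕜 Ω f =ᵐ[volume.restrict (Ω : Set Plane)] f :=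
  MemLp.coeFn_toLp (f.continuous.memLp_of_hasCompactSupport f.hasCompactSupport)

lemma inner_testToL2 (f g : 𝓓(Ω, 𝕜)) :
    inner 𝕜 (testToL2 𝕜 Ω f) (testToL2 𝕜 Ω g) = ∫ x, conj (f x) * g x := by
  rw [L2.inner_def, ← setIntegral_eq_integral_of_forall_compl_eq_zero (s := (Ω : Set Plane))
    (f := fun x => conj (f x) * g x)]
  · apply integral_congr_ae
    filter_upwards [coeFn_testToL2 f, coeFn_testToL2 g] with x hf hg
    rw [hf, hg, RCLike.inner_apply, mul_comm]
  · intro x hx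
    rw [testFunction_eq_zero_of_notMem g hx, mul_zero]

/-- Integration by parts for test functions. -/
lemma inner_testToL2_lineDerivOp_right (f g : 𝓓(Ω, 𝕜)) (v : Plane) :
    inner 𝕜 (testToL2 𝕜 Ω f) (testToL2 𝕜 Ω (∂_{v} g)) =
      -inner 𝕜 (testToL2 𝕜 Ω (∂_{v} f)) (testToL2 𝕜 Ω g) := by
  have hint (f g : 𝓓(Ω, 𝕜)) : Integrable (fun x => conj (f x) * g x) :=
    ((RCLike.continuous_conj.comp f.continuous).mul g.continuous).integrable_of_hasCompactSupport
      g.hasCompactSupport.mul_left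
  have hd (f : 𝓓(Ω, 𝕜)) (x : Plane) : HasLineDerivAt ℝ f ((∂_{v} f) x) x v := by
    rw [lineDerivOp_testFunction_apply]
    exact (f.contDiff.differentiable (by simp) x).hasFDerivAt.hasLineDerivAt v
  rw [inner_testToL2, inner_testToL2]
  exact integral_bilinear_hasLineDerivAt_right_eq_neg_left_of_integrable
    (B := (ContinuousLinearMap.mul ℝ 𝕜).comp (RCLike.conjCLE (K := 𝕜) : 𝕜 →L[ℝ] 𝕜))
    (hint _ _) (hint _ _) (hint _ _) (fun x _ => hd f x) (fun x _ => hd g x)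

/-- Multiplication of a test function by the `i`-th coordinate. -/
noncomputable def coordMul (i : Fin 2) (f : 𝓓(Ω, 𝕜)) : 𝓓(Ω, 𝕜) where
  toFun x := x i • f x
  contDiff' := by
    have h : ContDiff ℝ (⊤ : ℕ∞) fun x : Plane => x i := by fun_prop
    exact ContDiff.smul h f.contDiff
  hasCompactSupport' := HasCompactSupport.smul_left (f := fun x : Plane => x i)
    f.hasCompactSupport
  tsupport_subset' := (tsupport_smul_subset_right (fun x : Plane => x i) f).trans
    f.tsupport_subset

lemma coordMul_apply (i : Fin 2) (f : 𝓓(Ω, 𝕜)) (x : Plane) : coordMul i f x = x i • f x := rfl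

lemma lineDerivOp_coordMul (i : Fin 2) (f : 𝓓(Ω, 𝕜)) :
    ∂_{coordVec i} (coordMul i f) = f + coordMul i (∂_{coordVec i} f) := by
  ext x
  have h : HasFDerivAt (fun x : Plane => x i) (EuclideanSpace.proj i : Plane →L[ℝ] ℝ) x :=
    (EuclideanSpace.proj i : Plane →L[ℝ] ℝ).hasFDerivAt
  have h2 := h.smul (f.contDiff.differentiable (by simp) x).hasFDerivAt
  rw [lineDerivOp_testFunction_apply]
  change fderiv ℝ ((fun x : Plane => x i) • ⇑f) x _ = f x + x i • (∂_{coordVec i} f) x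
  rw [h2.fderiv, lineDerivOp_testFunction_apply]
  simp [coordVec, add_comm]

lemma norm_testToL2_coordMul_le {R : ℝ} (hR : ∀ x ∈ Ω, ‖x‖ ≤ R) (i : Fin 2) (f : 𝓓(Ω, 𝕜)) :
    ‖testToL2 𝕜 Ω (coordMul i f)‖ ≤ R * ‖testToL2 𝕜 Ω f‖ := by
  apply Lp.norm_le_mul_norm_of_ae_le_mul
  filter_upwards [coeFn_testToL2 f, coeFn_testToL2 (coordMul i f),
    ae_restrict_mem Ω.isOpen.measurableSet] with x hf hg hx
  rw [hf, hg, coordMul_apply, norm_smul]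
  gcongr
  exact (PiLp.norm_apply_le x i).trans (hR x hx)

/-- The Poincaré inequality for test functions. -/
lemma norm_testToL2_le {R : ℝ} (hR0 : 0 ≤ R) (hR : ∀ x ∈ Ω, ‖x‖ ≤ R) (i : Fin 2)
    (f : 𝓓(Ω, 𝕜)) :
    ‖testToL2 𝕜 Ω f‖ ≤ 2 * R * ‖testToL2 𝕜 Ω (∂_{coordVec i} f)‖ := by
  set T := testToL2 𝕜 Ω
  -- Integrating `∂ᵢ(xᵢ f)` against `f` by parts isolates `‖f‖²`, because `∂ᵢ(xᵢ f) = f + xᵢ ∂ᵢf`.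
  -- Each of the two other terms has size at most `R ‖f‖ ‖∂ᵢf‖`.
  have h := inner_testToL2_lineDerivOp_right (coordMul i f) f (coordVec i)
  rw [lineDerivOp_coordMul, map_add, inner_add_left, inner_self_eq_norm_sq_to_K] at h
  have h2 : ((‖T f‖ : 𝕜)) ^ 2 = -(inner 𝕜 (T (coordMul i f)) (T (∂_{coordVec i} f)) +
      inner 𝕜 (T (coordMul i (∂_{coordVec i} f))) (T f)) := by
    rw [h]; ring
  have h3 : ‖T f‖ ^ 2 ≤ ‖T (coordMul i f)‖ * ‖T (∂_{coordVec i} f)‖ +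
      ‖T (coordMul i (∂_{coordVec i} f))‖ * ‖T f‖ := by
    have := congrArg norm h2
    rw [norm_neg, norm_pow, RCLike.norm_ofReal, abs_norm] at this
    rw [this]
    exact (norm_add_le _ _).trans (add_le_add (norm_inner_le_norm _ _) (norm_inner_le_norm _ _))
  have h4 := norm_testToL2_coordMul_le hR i f
  have h5 := norm_testToL2_coordMul_le hR i (∂_{coordVec i} f)
  have h6 : ‖T f‖ ^ 2 ≤ (2 * R * ‖T (∂_{coordVec i} f)‖) * ‖T f‖ := by
    calc _ ≤ _ := h3
      _ ≤ (R * ‖T f‖) * ‖T (∂_{coordVec i} f)‖ + (R * ‖T (∂_{coordVec i} f)‖) * ‖T f‖ := by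
        gcongr
      _ = _ := by ring
  rcases (norm_nonneg (T f)).eq_or_lt with h0 | h0
  · rw [← h0]
    positivity
  · rw [sq] at h6
    exact le_of_mul_le_mul_right h6 h0

end TestFunctions

/-! ### The Laplacian as an equivalent norm on `H²₀`. -/

section Regularity

variable {𝕜 : Type*} [RCLike 𝕜] {Ω : Opens Plane}

/-- For test functions the Laplacian controls the whole Hessian. -/
lemma norm_sq_testToL2_laplacian (f : 𝓓(Ω, 𝕜)) :
    ‖(testJet 𝕜 Ω f).laplacian‖ ^ 2 = ∑ i, ∑ j, ‖(testJet 𝕜 Ω f).hess i j‖ ^ 2 := by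
  -- Two integrations by parts move one derivative across each way: `(∂₀∂₀f, ∂₁∂₁f) = ‖∂₁∂₀f‖²`.
  -- There is no boundary term.
  have hcross : inner 𝕜 ((testJet 𝕜 Ω f).hess 0 0) ((testJet 𝕜 Ω f).hess 1 1) =
      ((‖(testJet 𝕜 Ω f).hess 0 1‖ : 𝕜)) ^ 2 := by
    change inner 𝕜 (testToL2 𝕜 Ω (∂_{coordVec 0} (∂_{coordVec 0} f)))
      (testToL2 𝕜 Ω (∂_{coordVec 1} (∂_{coordVec 1} f))) =
      ((‖testToL2 𝕜 Ω (∂_{coordVec 1} (∂_{coordVec 0} f))‖ : 𝕜)) ^ 2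
    rw [inner_testToL2_lineDerivOp_right,
      lineDerivOp_testFunction_comm (∂_{coordVec 0} f) (coordVec 1) (coordVec 0),
      ← inner_testToL2_lineDerivOp_right, lineDerivOp_testFunction_comm f (coordVec 0) (coordVec 1),
      inner_self_eq_norm_sq_to_K]
  have hsymm : (testJet 𝕜 Ω f).hess 1 0 = (testJet 𝕜 Ω f).hess 0 1 :=
    congrArg (testToL2 𝕜 Ω) (lineDerivOp_testFunction_comm f (coordVec 0) (coordVec 1))
  rw [Jet.laplacian, norm_add_sq (𝕜 := 𝕜), hcross, Fin.sum_univ_two, Fin.sum_univ_two,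
    Fin.sum_univ_two, hsymm, ← RCLike.ofReal_pow, RCLike.ofReal_re]
  ring

lemma Jet.norm_sq_eq (J : Jet 𝕜 Ω) :
    ‖J‖ ^ 2 = ‖J.val‖ ^ 2 + (∑ i, ‖J.grad i‖ ^ 2 + ∑ i, ∑ j, ‖J.hess i j‖ ^ 2) := by
  rw [PiLp.norm_sq_eq_of_L2, Fintype.sum_sum_type, Fintype.sum_sum_type, Fintype.sum_prod_type]
  simp [Jet.val, Jet.grad, Jet.hess]

lemma norm_sq_testJet_le {R : ℝ} (hR0 : 0 ≤ R) (hR : ∀ x ∈ Ω, ‖x‖ ≤ R) (f : 𝓓(Ω, 𝕜)) :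
    ‖testJet 𝕜 Ω f‖ ^ 2 ≤
      ((2 * R) ^ 4 + (2 * R) ^ 2 + 1) * ‖(testJet 𝕜 Ω f).laplacian‖ ^ 2 := by
  -- Poincaré in direction `0` suffices. Used twice on `f` it gives the term `(2R)⁴`, used once on
  -- each `∂ᵢf` the term `(2R)²`; the Hessian itself contributes the `1`.
  have h0 : ‖(testJet 𝕜 Ω f).val‖ ≤ 2 * R * ‖(testJet 𝕜 Ω f).grad 0‖ :=
    norm_testToL2_le hR0 hR 0 f
  have h1 (i : Fin 2) : ‖(testJet 𝕜 Ω f).grad i‖ ≤ 2 * R * ‖(testJet 𝕜 Ω f).hess i 0‖ :=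
    norm_testToL2_le hR0 hR 0 _
  have h0' := pow_le_pow_left₀ (norm_nonneg _) h0 2
  have h1' (i : Fin 2) := pow_le_pow_left₀ (norm_nonneg _) (h1 i) 2
  have h2 := mul_le_mul_of_nonneg_left (h1' 0) (sq_nonneg (2 * R))
  rw [Jet.norm_sq_eq, norm_sq_testToL2_laplacian]
  simp only [Fin.sum_univ_two]
  have h10 := h1' 0
  have h11 := h1' 1
  simp only [mul_pow (2 * R)] at h0' h10 h11 h2
  have k1 : 0 ≤ (2 * R) ^ 4 * (‖(testJet 𝕜 Ω f).hess 0 1‖ ^ 2 +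
    ‖(testJet 𝕜 Ω f).hess 1 0‖ ^ 2 + ‖(testJet 𝕜 Ω f).hess 1 1‖ ^ 2) := by positivity
  have k2 : 0 ≤ (2 * R) ^ 2 * (‖(testJet 𝕜 Ω f).hess 0 1‖ ^ 2 +
    ‖(testJet 𝕜 Ω f).hess 1 1‖ ^ 2) := by positivity
  linarith

lemma Jet.norm_laplacian_le (J : Jet 𝕜 Ω) : ‖J.laplacian‖ ≤ 2 * ‖J‖ := by
  have h1 : ‖J.hess 0 0‖ ≤ ‖J‖ := PiLp.norm_apply_le J _
  have h2 : ‖J.hess 1 1‖ ≤ ‖J‖ := PiLp.norm_apply_le J _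
  calc _ ≤ ‖J.hess 0 0‖ + ‖J.hess 1 1‖ := norm_add_le _ _
    _ ≤ _ := by linarith

lemma Jet.continuous_laplacian : Continuous (Jet.laplacian : Jet 𝕜 Ω → L2 𝕜 Ω) := by
  unfold Jet.laplacian Jet.hess
  fun_prop

/-- The Laplacian controls the `H²` norm on `H²₀`. -/
lemma norm_sq_le_norm_sq_lap {R : ℝ} (hR0 : 0 ≤ R) (hR : ∀ x ∈ Ω, ‖x‖ ≤ R) (u : H20 𝕜 Ω) :
    ‖u‖ ^ 2 ≤ ((2 * R) ^ 4 + (2 * R) ^ 2 + 1) * ‖lap u‖ ^ 2 := by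
  -- The estimate is a closed condition in the jet norm, so it passes from test functions to their
  -- closure.
  have hcl : IsClosed {J : Jet 𝕜 Ω |
      ‖J‖ ^ 2 ≤ ((2 * R) ^ 4 + (2 * R) ^ 2 + 1) * ‖J.laplacian‖ ^ 2} :=
    isClosed_le (by fun_prop) ((Jet.continuous_laplacian.norm.pow 2).const_mul _)
  refine hcl.closure_subset_iff.2 ?_ u.2.2
  rintro _ ⟨f, rfl⟩
  exact norm_sq_testJet_le hR0 hR f

/-- The Laplacian on `H²₀` as a continuous linear map. -/
noncomputable def lapCLM (𝕜 : Type*) [RCLike 𝕜] (Ω : Opens Plane) : H20 𝕜 Ω →L[𝕜] L2 𝕜 Ω :=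
  LinearMap.mkContinuous
    { toFun := lap
      map_add' := fun _ _ => add_add_add_comm _ _ _ _
      map_smul' := fun c _ => (smul_add c _ _).symm }
    2 fun u => Jet.norm_laplacian_le (u : Jet 𝕜 Ω)

lemma lapCLM_apply (u : H20 𝕜 Ω) : lapCLM 𝕜 Ω u = lap u := rfl

lemma norm_lap_le (u : H20 𝕜 Ω) : ‖lap u‖ ≤ 2 * ‖u‖ := Jet.norm_laplacian_le (u : Jet 𝕜 Ω)

end Regularity

/-! ### Weighted `L²` products as Hilbert space products. -/

section Weights

variable {𝕜 : Type*} [RCLike 𝕜] {Ω : Opens Plane}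

/-- Multiplication by an essentially bounded weight, as an operator on `L²`. -/
lemma exists_weight_operator {w : Plane → ℝ} {B : ℝ}
    (hw : AEMeasurable w (volume.restrict (Ω : Set Plane)))
    (hB : ∀ᵐ x ∂(volume.restrict (Ω : Set Plane)), |w x| ≤ B) :
    ∃ W : L2 𝕜 Ω →L[𝕜] L2 𝕜 Ω,
      ∀ f, W f =ᵐ[volume.restrict (Ω : Set Plane)] fun x => (w x : 𝕜) * f x := by
  have hm : MemLp (fun x => (w x : 𝕜)) ∞ (volume.restrict (Ω : Set Plane)) :=
    memLp_top_of_bound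
      (RCLike.continuous_ofReal.comp_aestronglyMeasurable hw.aestronglyMeasurable) B
      (by simpa using hB)
  refine ⟨(ContinuousLinearMap.mul 𝕜 𝕜).holderL _ ∞ 2 2 hm.toLp, fun f => ?_⟩
  filter_upwards [(ContinuousLinearMap.mul 𝕜 𝕜).coeFn_holder (r := 2) hm.toLp f, hm.coeFn_toLp]
    with x hx hx'
  rw [← hx']
  exact hx

/-- Linearity and Cauchy–Schwarz for weighted products are read off from this form. The slots swap
because `inner` is conjugate-linear in its first argument. -/
lemma wInner_eq_inner {w : Plane → ℝ} {W : L2 𝕜 Ω →L[𝕜] L2 𝕜 Ω}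
    (hW : ∀ f, W f =ᵐ[volume.restrict (Ω : Set Plane)] fun x => (w x : 𝕜) * f x)
    (f g : L2 𝕜 Ω) : wInner w f g = inner 𝕜 g (W f) := by
  rw [L2.inner_def, wInner]
  apply integral_congr_ae
  filter_upwards [hW f] with x hx
  rw [hx, RCLike.inner_apply]

lemma l2Inner_eq_inner (f g : L2 𝕜 Ω) : l2Inner f g = inner 𝕜 g f := by
  rw [l2Inner, wInner_eq_inner (W := ContinuousLinearMap.id 𝕜 _)]
  · rfl
  · intro f
    simp

lemma norm_wInner_le {w : Plane → ℝ} {B : ℝ}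
    (hw : AEMeasurable w (volume.restrict (Ω : Set Plane)))
    (hB : ∀ᵐ x ∂(volume.restrict (Ω : Set Plane)), |w x| ≤ B) (f g : L2 𝕜 Ω) :
    ‖wInner w f g‖ ≤ B * ‖f‖ * ‖g‖ := by
  obtain ⟨W, hW⟩ := exists_weight_operator (𝕜 := 𝕜) hw hB
  have hf : ‖W f‖ ≤ B * ‖f‖ := by
    apply Lp.norm_le_mul_norm_of_ae_le_mul
    filter_upwards [hW f, hB] with x hx hx'
    rw [hx, norm_mul, RCLike.norm_ofReal]
    gcongr
  rw [wInner_eq_inner hW, mul_comm]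
  exact (norm_inner_le_norm _ _).trans (by gcongr)

lemma integrable_wInner {w : Plane → ℝ} {B : ℝ}
    (hw : AEMeasurable w (volume.restrict (Ω : Set Plane)))
    (hB : ∀ᵐ x ∂(volume.restrict (Ω : Set Plane)), |w x| ≤ B) (f g : L2 𝕜 Ω) :
    Integrable (fun x => (w x : 𝕜) * f x * conj (g x)) (volume.restrict (Ω : Set Plane)) := by
  obtain ⟨W, hW⟩ := exists_weight_operator (𝕜 := 𝕜) hw hB
  refine (L2.integrable_inner (𝕜 := 𝕜) g (W f)).congr ?_
  filter_upwards [hW f] with x hx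
  rw [hx, RCLike.inner_apply]

end Weights

/-! ### Continuity of the form and coercivity of its `(u, y)` block. -/

section Form

variable {𝕜 : Type*} [RCLike 𝕜] {Ω : Opens Plane}

lemma U.norm_sq_eq (w : U 𝕜 Ω) : ‖w‖ ^ 2 = ‖w.u‖ ^ 2 + (‖w.y‖ ^ 2 + ‖w.p‖ ^ 2) := by
  rw [WithLp.prod_norm_sq_eq_of_L2, WithLp.prod_norm_sq_eq_of_L2 w.snd]
  rfl

lemma U.norm_u_le (w : U 𝕜 Ω) : ‖w.u‖ ≤ ‖w‖ :=
  (sq_le_sq₀ (norm_nonneg _) (norm_nonneg _)).1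
    (by rw [U.norm_sq_eq w]; nlinarith [sq_nonneg ‖w.y‖, sq_nonneg ‖w.p‖])

lemma U.norm_y_le (w : U 𝕜 Ω) : ‖w.y‖ ≤ ‖w‖ :=
  (sq_le_sq₀ (norm_nonneg _) (norm_nonneg _)).1
    (by rw [U.norm_sq_eq w]; nlinarith [sq_nonneg ‖w.u‖, sq_nonneg ‖w.p‖])

lemma U.norm_p_le (w : U 𝕜 Ω) : ‖w.p‖ ≤ ‖w‖ :=
  (sq_le_sq₀ (norm_nonneg _) (norm_nonneg _)).1
    (by rw [U.norm_sq_eq w]; nlinarith [sq_nonneg ‖w.u‖, sq_nonneg ‖w.y‖])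

lemma ae_abs_one_add_le {w : Plane → ℝ} {B : ℝ}
    (hB : ∀ᵐ x ∂(volume.restrict (Ω : Set Plane)), |w x| ≤ B) :
    ∀ᵐ x ∂(volume.restrict (Ω : Set Plane)), |1 + w x| ≤ 1 + B := by
  filter_upwards [hB] with x hx
  exact (abs_add_le _ _).trans (by rw [abs_one]; linarith)

/-- With `‖Δu‖ ≤ 2 ‖u‖`, the six terms contribute `4B + 2B + 2B + (1 + B) + 1 + 1`. -/
lemma norm_aU_le {α : Plane → ℝ} {B : ℝ} (hB0 : 0 ≤ B)
    (hα : AEMeasurable α (volume.restrict (Ω : Set Plane)))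
    (hB : ∀ᵐ x ∂(volume.restrict (Ω : Set Plane)), |α x| ≤ B) (w w' : U 𝕜 Ω) :
    ‖aU α w w'‖ ≤ (9 * B + 3) * ‖w‖ * ‖w'‖ := by
  have hu (w : U 𝕜 Ω) : ‖lap w.u‖ ≤ 2 * ‖w‖ :=
    (norm_lap_le w.u).trans (by linarith [w.norm_u_le])
  have hmul {b x y X Y : ℝ} (hb : 0 ≤ b) (hx0 : 0 ≤ x) (hy0 : 0 ≤ y) (hx : x ≤ X) (hy : y ≤ Y) :
      b * x * y ≤ b * X * Y :=
    mul_le_mul (mul_le_mul_of_nonneg_left hx hb) hy hy0 (mul_nonneg hb (hx0.trans hx))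
  have h1 : ‖wInner α (lap w.u) (lap w'.u)‖ ≤ B * (2 * ‖w‖) * (2 * ‖w'‖) :=
    (norm_wInner_le hα hB _ _).trans (hmul hB0 (norm_nonneg _) (norm_nonneg _) (hu w) (hu w'))
  have h2 : ‖wInner α w.y (lap w'.u)‖ ≤ B * ‖w‖ * (2 * ‖w'‖) :=
    (norm_wInner_le hα hB _ _).trans (hmul hB0 (norm_nonneg _) (norm_nonneg _) w.norm_y_le (hu w'))
  have h3 : ‖wInner α (lap w.u) w'.y‖ ≤ B * (2 * ‖w‖) * ‖w'‖ :=
    (norm_wInner_le hα hB _ _).trans (hmul hB0 (norm_nonneg _) (norm_nonneg _) (hu w) w'.norm_y_le)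
  have h4 : ‖wInner (fun x => 1 + α x) w.y w'.y‖ ≤ (1 + B) * ‖w‖ * ‖w'‖ :=
    (norm_wInner_le (hα.const_add 1) (ae_abs_one_add_le hB) _ _).trans
      (hmul (by positivity) (norm_nonneg _) (norm_nonneg _) w.norm_y_le w'.norm_y_le)
  have h5 : ‖(l2Inner w.p w'.y : 𝕜)‖ ≤ ‖w‖ * ‖w'‖ := by
    rw [l2Inner_eq_inner, mul_comm]
    exact (norm_inner_le_norm _ _).trans
      (mul_le_mul w'.norm_y_le w.norm_p_le (norm_nonneg _) (norm_nonneg _))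
  have h6 : ‖(l2Inner w.y w'.p : 𝕜)‖ ≤ ‖w‖ * ‖w'‖ := by
    rw [l2Inner_eq_inner, mul_comm]
    exact (norm_inner_le_norm _ _).trans
      (mul_le_mul w'.norm_p_le w.norm_y_le (norm_nonneg _) (norm_nonneg _))
  unfold aU aBlock
  refine (norm_sub_le_of_le (norm_sub_le_of_le (norm_add_le_of_le (norm_add_le_of_le
    (norm_add_le_of_le h1 h2) h3) h4) h5) h6).trans (le_of_eq ?_)
  ring

/-- `a_{U,α}` as a continuous sesquilinear form. -/
lemma exists_sesquilinear_aU {α : Plane → ℝ} {B : ℝ} (hB0 : 0 ≤ B)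
    (hα : AEMeasurable α (volume.restrict (Ω : Set Plane)))
    (hB : ∀ᵐ x ∂(volume.restrict (Ω : Set Plane)), |α x| ≤ B) :
    ∃ A : U 𝕜 Ω →L[𝕜] U 𝕜 Ω →L⋆[𝕜] 𝕜, ∀ w w', A w w' = aU α w w' := by
  obtain ⟨W, hW⟩ := exists_weight_operator (𝕜 := 𝕜) hα hB
  obtain ⟨W', hW'⟩ := exists_weight_operator (𝕜 := 𝕜) (hα.const_add 1) (ae_abs_one_add_le hB)
  have key (w w' : U 𝕜 Ω) : aU α w w' =
      inner 𝕜 (lapCLM 𝕜 Ω w'.u) (W (lapCLM 𝕜 Ω w.u)) + inner 𝕜 (lapCLM 𝕜 Ω w'.u) (W w.y) +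
        inner 𝕜 w'.y (W (lapCLM 𝕜 Ω w.u)) + inner 𝕜 w'.y (W' w.y) -
        inner 𝕜 w'.y w.p - inner 𝕜 w'.p w.y := by
    simp only [aU, aBlock, wInner_eq_inner hW, wInner_eq_inner hW', l2Inner_eq_inner, lapCLM_apply]
  have hua (w w' : U 𝕜 Ω) : (w + w').u = w.u + w'.u := rfl
  have hya (w w' : U 𝕜 Ω) : (w + w').y = w.y + w'.y := rfl
  have hpa (w w' : U 𝕜 Ω) : (w + w').p = w.p + w'.p := rfl
  have hus (c : 𝕜) (w : U 𝕜 Ω) : (c • w).u = c • w.u := rfl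
  have hys (c : 𝕜) (w : U 𝕜 Ω) : (c • w).y = c • w.y := rfl
  have hps (c : 𝕜) (w : U 𝕜 Ω) : (c • w).p = c • w.p := rfl
  refine ⟨LinearMap.mkContinuous₂ (LinearMap.mk₂'ₛₗ (RingHom.id 𝕜) (starRingEnd 𝕜) (aU α)
    ?_ ?_ ?_ ?_) (9 * B + 3) (norm_aU_le hB0 hα hB), fun w w' => rfl⟩
  · intro w₁ w₂ w'
    simp only [key, hua, hya, hpa, map_add, inner_add_right]
    ring
  · intro c w w'
    simp only [key, hus, hys, hps, map_smul, inner_smul_right, RingHom.id_apply, smul_eq_mul]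
    ring
  · intro w w₁ w₂
    simp only [key, hua, hya, hpa, map_add, inner_add_left]
    ring
  · intro c w w'
    simp only [key, hus, hys, hps, map_smul, inner_smul_left, smul_eq_mul]
    ring

/-- The quadratic form `|a|² + 2 Re(a b̄) + s |b|²` is bounded below for `s > 1`. -/
lemma le_norm_sq_add_two_re_add {ns s t : ℝ} (hns : 1 < ns) (hs : ns ≤ s) {nb : ℝ} (hsb : s ≤ nb)
    (ht : t = 1 / (s - 1)) (a b : 𝕜) :
    1 / (nb - 1) * (1 - √(1 / ns)) * (‖b‖ ^ 2 + ‖a‖ ^ 2) ≤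
      t * ‖a‖ ^ 2 + 2 * (t * RCLike.re (a * conj b)) + (1 + t) * ‖b‖ ^ 2 := by
  have hs1 : 0 < s - 1 := by linarith
  have ht0 : 0 < t := by rw [ht]; positivity
  have hts : 1 + t = t * s := by rw [ht]; field_simp; ring
  have hnt : 1 / (nb - 1) ≤ t := by
    rw [ht]; exact one_div_le_one_div_of_le hs1 (by linarith)
  set r := √(1 / ns) with hr
  have hr0 : 0 < r := Real.sqrt_pos.2 (by positivity)
  have hr2 : r ^ 2 * ns = 1 := by
    rw [hr, Real.sq_sqrt (by positivity)]; field_simp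
  have hr1 : r < 1 := by
    by_contra! h
    have := one_le_pow₀ h (n := 2)
    nlinarith
  have hre : -(‖a‖ * ‖b‖) ≤ RCLike.re (a * conj b) := by
    have := RCLike.abs_re_le_norm (a * conj b)
    rw [norm_mul, RCLike.norm_conj] at this
    exact (abs_le.1 this).1
  have hquad : (1 - r) * (‖b‖ ^ 2 + ‖a‖ ^ 2) ≤
      ‖a‖ ^ 2 + 2 * RCLike.re (a * conj b) + s * ‖b‖ ^ 2 := by
    -- Young's inequality with weight `r = 1/√ns`, for which `ns * r = 1/r`. What remains is `(1 -
    -- r)‖a‖² + (s - ns * r)‖b‖²`, and `s - ns * r ≥ ns * (1 - r) ≥ 1 - r`.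
    have h1 : 2 * (‖a‖ * ‖b‖) ≤ r * ‖a‖ ^ 2 + ns * r * ‖b‖ ^ 2 := by
      have h := mul_nonneg hr0.le (sq_nonneg (‖a‖ - ns * r * ‖b‖))
      have e : r * (‖a‖ - ns * r * ‖b‖) ^ 2 =
          r * ‖a‖ ^ 2 - 2 * (r ^ 2 * ns) * (‖a‖ * ‖b‖) + (r ^ 2 * ns) * (ns * r) * ‖b‖ ^ 2 := by
        ring
      rw [e, hr2] at h
      linarith
    have h2 : (1 - r) * ‖b‖ ^ 2 ≤ ns * (1 - r) * ‖b‖ ^ 2 := by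
      have : 0 ≤ (ns - 1) * ((1 - r) * ‖b‖ ^ 2) :=
        mul_nonneg (by linarith) (mul_nonneg (by linarith) (sq_nonneg _))
      linarith
    have h3 : ns * ‖b‖ ^ 2 ≤ s * ‖b‖ ^ 2 := by gcongr
    linarith
  calc _ ≤ t * (1 - r) * (‖b‖ ^ 2 + ‖a‖ ^ 2) := by
        gcongr
    _ = t * ((1 - r) * (‖b‖ ^ 2 + ‖a‖ ^ 2)) := by ring
    _ ≤ t * (‖a‖ ^ 2 + 2 * RCLike.re (a * conj b) + s * ‖b‖ ^ 2) := by gcongr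
    _ = _ := by rw [hts]; ring

/-- Coercivity of the `(u, y)` block. -/
lemma le_re_aBlock_self {ns nb B : ℝ} (hns : 1 < ns) {n : Plane → ℝ}
    (hα : AEMeasurable (alphaOf n) (volume.restrict (Ω : Set Plane)))
    (hB : ∀ᵐ x ∂(volume.restrict (Ω : Set Plane)), |alphaOf n x| ≤ B)
    (hn : ∀ᵐ x ∂(volume.restrict (Ω : Set Plane)), ns ≤ n x ∧ n x ≤ nb)
    (u : H20 𝕜 Ω) (y : L2 𝕜 Ω) :
    1 / (nb - 1) * (1 - √(1 / ns)) * (‖y‖ ^ 2 + ‖lap u‖ ^ 2) ≤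
      RCLike.re (aBlock (alphaOf n) u y u y) := by
  have hsq (f : L2 𝕜 Ω) : ‖f‖ ^ 2 = ∫ x in (Ω : Set Plane), ‖f x‖ ^ 2 := by
    rw [← RCLike.ofReal_re (K := 𝕜) (‖f‖ ^ 2), RCLike.ofReal_pow, ← inner_self_eq_norm_sq_to_K,
      L2.inner_def, ← integral_re (L2.integrable_inner f f)]
    simp only [inner_self_eq_norm_sq]
  have hsqi (f : L2 𝕜 Ω) : Integrable (fun x => ‖f x‖ ^ 2) (volume.restrict (Ω : Set Plane)) :=
    (Lp.memLp f).integrable_norm_pow (by simp)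
  have i1 := integrable_wInner hα hB (lap u) (lap u)
  have i2 := integrable_wInner hα hB y (lap u)
  have i3 := integrable_wInner hα hB (lap u) y
  have i4 := integrable_wInner (hα.const_add 1) (ae_abs_one_add_le hB) y y
  unfold aBlock wInner
  rw [← integral_add' i1 i2, ← integral_add' (i1.add i2) i3,
    ← integral_add' ((i1.add i2).add i3) i4,
    ← integral_re (((i1.add i2).add i3).add i4), hsq, hsq, ← integral_add (hsqi _) (hsqi _),
    ← integral_const_mul]
  refine integral_mono_ae (((hsqi _).add (hsqi _)).const_mul _)
    (((i1.add i2).add i3).add i4).re ?_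
  filter_upwards [hn] with x hx
  refine (le_norm_sq_add_two_re_add hns hx.1 hx.2 (t := alphaOf n x) rfl
    (lap u x) (y x)).trans (le_of_eq ?_)
  have hswap : RCLike.re (y x * conj (lap u x)) = RCLike.re (lap u x * conj (y x)) := by
    rw [← RCLike.conj_re, map_mul, RCLike.conj_conj, mul_comm]
  simp only [Pi.add_apply, map_add (RCLike.re (K := 𝕜)), mul_assoc, RCLike.re_ofReal_mul,
    hswap, RCLike.mul_conj,
    ← RCLike.ofReal_pow, RCLike.ofReal_re]
  ring

end Form

/-! ### The inf-sup conditions. -/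

section InfSup

variable {𝕜 : Type*} [RCLike 𝕜] {Ω : Opens Plane}

lemma le_infSup_of_exists {X Y : Type*} [NormedAddCommGroup X] [NormedAddCommGroup Y]
    {a : X → Y → ℝ} {C : ℝ}
    (h : ∀ y, y ≠ 0 → ∃ x, x ≠ 0 ∧ C * (‖x‖ * ‖y‖) ≤ a x y) : (C : EReal) ≤ infSup a := by
  refine le_iInf fun y => ?_
  obtain ⟨x, hx, hC⟩ := h y.1 y.2
  refine le_iSup_of_le ⟨x, hx⟩ ?_
  rw [EReal.coe_le_coe_iff, le_div_iff₀ (mul_pos (norm_pos_iff.2 hx) (norm_pos_iff.2 y.2))]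
  exact hC

/-- The pairing of `L²` with itself has inf-sup number one. -/
lemma infSup_l2Inner [Nontrivial (L2 𝕜 Ω)] :
    infSup (fun y q : L2 𝕜 Ω => RCLike.re (l2Inner y q)) = 1 := by
  apply le_antisymm
  -- A nonzero `q` is needed here: an infimum over an empty family would be `⊤`.
  · obtain ⟨q, hq⟩ := exists_ne (0 : L2 𝕜 Ω)
    refine iInf_le_of_le ⟨q, hq⟩ (iSup_le fun y => ?_)
    rw [← EReal.coe_one, EReal.coe_le_coe_iff]
    refine div_le_one_of_le₀ ?_ (by positivity)
    change RCLike.re (l2Inner y.1 q) ≤ ‖y.1‖ * ‖q‖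
    rw [l2Inner_eq_inner, mul_comm]
    exact re_inner_le_norm _ _
  · rw [← EReal.coe_one]
    refine le_infSup_of_exists fun q hq => ⟨q, hq, ?_⟩
    rw [l2Inner_eq_inner, inner_self_eq_norm_mul_norm, one_mul]

lemma nontrivial_L2 (hne : (Ω : Set Plane).Nonempty) (hbdd : Bornology.IsBounded (Ω : Set Plane)) :
    Nontrivial (L2 𝕜 Ω) := by
  have hpos : (volume.restrict (Ω : Set Plane)) Set.univ ≠ 0 := by
    rw [Measure.restrict_apply_univ]
    exact (Ω.isOpen.measure_pos volume hne).ne'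
  have hfin : (volume.restrict (Ω : Set Plane)) Set.univ ≠ ∞ := by
    rw [Measure.restrict_apply_univ]
    exact hbdd.measure_lt_top.ne
  refine ⟨indicatorConstLp 2 MeasurableSet.univ hfin 1, 0, fun h => ?_⟩
  have h1 := congrArg norm h
  rw [norm_indicatorConstLp (by simp) (by simp), norm_zero, norm_one, one_mul] at h1
  exact (Real.rpow_pos_of_pos (ENNReal.toReal_pos hpos hfin) _).ne' h1

/-- Here `X`, `Z`, `Q` stand for `‖Δu‖`, `‖y‖`, `‖p‖` and `N` for `1 + B`. Completing squares in `N
Q X` and `N Q Z` costs half of `δ Q²` and, by the smallness of `δ`, half of the coercive part. -/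
lemma young_lower_bound {c N δ X Z Q : ℝ} (hδ : 0 ≤ δ) (hc : δ * N ^ 2 ≤ c / 2) :
    min (c / 2) (δ / 2) * (X ^ 2 + (Z ^ 2 + Q ^ 2)) ≤
      c * (Z ^ 2 + X ^ 2) - δ * (N * Q * (X + Z)) + δ * Q ^ 2 := by
  have h1 : min (c / 2) (δ / 2) * (X ^ 2 + Z ^ 2) ≤ c / 2 * (X ^ 2 + Z ^ 2) := by
    gcongr; exact min_le_left _ _
  have h2 : min (c / 2) (δ / 2) * Q ^ 2 ≤ δ / 2 * Q ^ 2 := by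
    gcongr; exact min_le_right _ _
  have h3 : δ * N ^ 2 * (X ^ 2 + Z ^ 2) ≤ c / 2 * (X ^ 2 + Z ^ 2) := by gcongr
  have h4 : 0 ≤ δ * ((Q / 2 - N * X) ^ 2 + (Q / 2 - N * Z) ^ 2) := by positivity
  linarith

/-- The inf-sup condition for `a_{U,α}`, from coercivity of the `(u, y)` block and control of the
`H²` norm by the Laplacian. -/
lemma infSup_aU_ge {α : Plane → ℝ} {B c K δ : ℝ} (hB0 : 0 ≤ B) (hc0 : 0 < c) (hK : 1 ≤ K)
    (hδ : 0 < δ) (hδc : δ * (1 + B) ^ 2 ≤ c / 2)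
    (hα : AEMeasurable α (volume.restrict (Ω : Set Plane)))
    (hB : ∀ᵐ x ∂(volume.restrict (Ω : Set Plane)), |α x| ≤ B)
    (hlap : ∀ u : H20 𝕜 Ω, ‖u‖ ^ 2 ≤ K * ‖lap u‖ ^ 2)
    (hcoer : ∀ (u : H20 𝕜 Ω) (y : L2 𝕜 Ω),
      c * (‖y‖ ^ 2 + ‖lap u‖ ^ 2) ≤ RCLike.re (aBlock α u y u y)) :
    ((min (c / 2) (δ / 2) / K / (2 + 2 * δ) : ℝ) : EReal) ≤
      infSup (fun w w' : U 𝕜 Ω => RCLike.re (aU α w w')) := by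
  obtain ⟨W, hW⟩ := exists_weight_operator (𝕜 := 𝕜) hα hB
  obtain ⟨W', hW'⟩ := exists_weight_operator (𝕜 := 𝕜) (hα.const_add 1) (ae_abs_one_add_le hB)
  have hK0 : 0 < K := by linarith
  set m := min (c / 2) (δ / 2)
  have hm0 : 0 < m := lt_min (by positivity) (by positivity)
  refine le_infSup_of_exists fun w hw => ?_
  -- The sign of the third component makes `(p, y) - (y, p)` vanish in real part; the shift of the
  -- second turns `-(y, p)` into `-(y, p) + δ ‖p‖²`.
  set w₀ : U 𝕜 Ω := WithLp.toLp 2 (w.u, WithLp.toLp 2 (w.y - (δ : 𝕜) • w.p, -w.p))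
  have hpos : 0 < ‖w‖ := norm_pos_iff.2 hw
  have hval : RCLike.re (aU α w₀ w) = RCLike.re (aBlock α w.u w.y w.u w.y) -
      δ * RCLike.re (wInner α w.p (lap w.u) + wInner (fun x => 1 + α x) w.p w.y) +
      δ * ‖w.p‖ ^ 2 := by
    have e1 : w₀.u = w.u := rfl
    have e2 : w₀.y = w.y - (δ : 𝕜) • w.p := rfl
    have e3 : w₀.p = -w.p := rfl
    have hs := inner_re_symm (𝕜 := 𝕜) w.y w.p
    simp only [aU, aBlock, wInner_eq_inner hW, wInner_eq_inner hW', l2Inner_eq_inner, e1, e2, e3,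
      map_sub, map_smul, inner_sub_right, inner_smul_right, inner_neg_right, map_add, map_neg,
      RCLike.re_ofReal_mul, inner_self_eq_norm_sq]
    linarith
  have hcross : RCLike.re (wInner α w.p (lap w.u) + wInner (fun x => 1 + α x) w.p w.y : 𝕜) ≤
      (1 + B) * ‖w.p‖ * (‖lap w.u‖ + ‖w.y‖) := by
    have h1 := norm_wInner_le hα hB w.p (lap w.u)
    have h2 := norm_wInner_le (hα.const_add 1) (ae_abs_one_add_le hB) w.p w.y
    have h3 : 0 ≤ ‖w.p‖ * ‖lap w.u‖ := by positivity
    refine (RCLike.re_le_norm _).trans ((norm_add_le_of_le h1 h2).trans ?_)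
    linarith
  have hlow : m / K * ‖w‖ ^ 2 ≤ RCLike.re (aU α w₀ w) := by
    have h1 : ‖w‖ ^ 2 ≤ K * (‖lap w.u‖ ^ 2 + (‖w.y‖ ^ 2 + ‖w.p‖ ^ 2)) := by
      have : 0 ≤ (K - 1) * (‖w.y‖ ^ 2 + ‖w.p‖ ^ 2) :=
        mul_nonneg (by linarith) (by positivity)
      rw [U.norm_sq_eq]
      linarith [hlap w.u]
    calc m / K * ‖w‖ ^ 2 ≤ m / K * (K * (‖lap w.u‖ ^ 2 + (‖w.y‖ ^ 2 + ‖w.p‖ ^ 2))) := by gcongr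
      _ = m * (‖lap w.u‖ ^ 2 + (‖w.y‖ ^ 2 + ‖w.p‖ ^ 2)) := by field_simp
      _ ≤ _ := young_lower_bound hδ.le hδc
      _ ≤ _ := by
        rw [hval]
        have := mul_le_mul_of_nonneg_left hcross hδ.le
        linarith [hcoer w.u w.y]
  have hup : ‖w₀‖ ≤ (2 + 2 * δ) * ‖w‖ := by
    refine (sq_le_sq₀ (norm_nonneg _) (by positivity)).1 ?_
    have h1 : ‖w.y - (δ : 𝕜) • w.p‖ ^ 2 ≤ 2 * ‖w.y‖ ^ 2 + 2 * (δ ^ 2 * ‖w.p‖ ^ 2) := by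
      have : ‖w.y - (δ : 𝕜) • w.p‖ ≤ ‖w.y‖ + δ * ‖w.p‖ := by
        refine (norm_sub_le _ _).trans ?_
        rw [norm_smul, RCLike.norm_ofReal, abs_of_pos hδ]
      have h := pow_le_pow_left₀ (norm_nonneg _) this 2
      nlinarith [sq_nonneg (‖w.y‖ - δ * ‖w.p‖)]
    have h2 : ‖w₀‖ ^ 2 = ‖w.u‖ ^ 2 + (‖w.y - (δ : 𝕜) • w.p‖ ^ 2 + ‖w.p‖ ^ 2) := by
      rw [U.norm_sq_eq, ← norm_neg w.p]
      rfl
    rw [h2, mul_pow, U.norm_sq_eq]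
    have h3 : 0 ≤ (δ ^ 2) * ‖w.u‖ ^ 2 := by positivity
    have h4 : 0 ≤ (δ ^ 2) * ‖w.y‖ ^ 2 := by positivity
    have h5 : 0 ≤ (δ ^ 2) * ‖w.p‖ ^ 2 := by positivity
    have h6 : 0 ≤ δ * (‖w.u‖ ^ 2 + (‖w.y‖ ^ 2 + ‖w.p‖ ^ 2)) := by positivity
    have h7 : 0 ≤ ‖w.u‖ ^ 2 := by positivity
    have h8 : 0 ≤ ‖w.y‖ ^ 2 := by positivity
    have h9 : 0 ≤ ‖w.p‖ ^ 2 := by positivity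
    linarith
  refine ⟨w₀, fun h0 => ?_, ?_⟩
  -- If `w₀` were zero, the form would vanish there, against the positive lower bound `hlow`.
  · obtain ⟨A, hA⟩ := exists_sesquilinear_aU (𝕜 := 𝕜) hB0 hα hB
    rw [h0, ← hA, map_zero, zero_apply, map_zero] at hlow
    have : 0 < m / K * ‖w‖ ^ 2 := by positivity
    linarith
  · calc m / K / (2 + 2 * δ) * (‖w₀‖ * ‖w‖)
        ≤ m / K / (2 + 2 * δ) * ((2 + 2 * δ) * ‖w‖ * ‖w‖) := by gcongr
      _ = m / K * ‖w‖ ^ 2 := by field_simp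
      _ ≤ _ := hlow

end InfSup

end TransmissionEigenvalue

/-! ### Choice of the constants and conclusion. -/

theorem mainTheorem4 {𝕜 : Type*} [RCLike 𝕜] (Ω : Opens Plane)
    (hne : (Ω : Set Plane).Nonempty)
    (hbdd : Bornology.IsBounded (Ω : Set Plane))
    (ns nb : ℝ) (hns : 1 < ns) :
    (∃ M C : ℝ, 0 < M ∧ 0 < C ∧
      ∀ n : Plane → ℝ,
        AEMeasurable n (volume.restrict (Ω : Set Plane)) →
        (∀ᵐ x ∂(volume.restrict (Ω : Set Plane)),
          ns ≤ n x ∧ n x ≤ nb) →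
        -- `a_{U,α}` is a continuous sesquilinear form (bilinear when `𝕜 = ℝ`)
        (∃ A : U 𝕜 Ω →L[𝕜] U 𝕜 Ω →L⋆[𝕜] 𝕜,
          (∀ w w', A w w' =
            aU (alphaOf n) w w') ∧
          ∀ w w', ‖A w w'‖ ≤ M * ‖w‖ * ‖w'‖) ∧
        -- the inf-sup condition
        (C : EReal) ≤ infSup
          (fun w w' : U 𝕜 Ω =>
            RCLike.re (aU (alphaOf n) w w')) ∧
        -- coercivity of the `(u, y)` block
        (∀ (u : H20 𝕜 Ω) (y : L2 𝕜 Ω),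
          1 / (nb - 1) * (1 - √(1 / ns)) *
              (‖y‖ ^ 2 + ‖lap u‖ ^ 2) ≤
            RCLike.re (aBlock
              (alphaOf n) u y u y))) ∧
    -- the inf-sup constant of the pairing of `y` and `q`
    infSup
      (fun y q : L2 𝕜 Ω =>
        RCLike.re (l2Inner y q)) = 1 := by
  have := nontrivial_L2 (𝕜 := 𝕜) hne hbdd
  refine ⟨?_, infSup_l2Inner⟩
  -- If `nb < ns` no `n` is admissible, since `Ω` has positive measure, and any constants serve.
  -- Otherwise `nb > 1`, which makes the coercivity constant `c` positive.
  rcases lt_or_ge nb ns with hlt | hle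
  · refine ⟨1, 1, one_pos, one_pos, fun n _ hn => ?_⟩
    have : (ae (volume.restrict (Ω : Set Plane))).NeBot := by
      rw [ae_neBot, Ne, Measure.restrict_eq_zero]
      exact (Ω.isOpen.measure_pos volume hne).ne'
    obtain ⟨x, hx⟩ := hn.exists
    linarith [hx.1, hx.2]
  obtain ⟨R, hR0, hR⟩ := hbdd.exists_pos_norm_le
  set B := 1 / (ns - 1)
  have hB0 : 0 < B := one_div_pos.2 (by linarith)
  set c := 1 / (nb - 1) * (1 - √(1 / ns))
  have hc0 : 0 < c := by
    refine mul_pos (one_div_pos.2 (by linarith)) (sub_pos.2 ?_)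
    rw [Real.sqrt_lt' one_pos, one_pow]
    exact (div_lt_one (by linarith)).2 hns
  set K := (2 * R) ^ 4 + (2 * R) ^ 2 + 1
  have hK : 1 ≤ K := le_add_of_nonneg_left (by positivity)
  -- The largest `δ` for which `young_lower_bound` absorbs the cross terms. It depends on `ns` and
  -- `nb` only, as `B` bounds every admissible `α`.
  set δ := c / 2 / (1 + B) ^ 2
  have hδ : 0 < δ := by positivity
  have hδc : δ * (1 + B) ^ 2 ≤ c / 2 := (div_mul_cancel₀ _ (by positivity)).le
  refine ⟨9 * B + 3, min (c / 2) (δ / 2) / K / (2 + 2 * δ), by positivity,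
    div_pos (div_pos (lt_min (by positivity) (by positivity)) (by linarith)) (by positivity),
    fun n hmeas hn => ?_⟩
  have hα : AEMeasurable (alphaOf n) (volume.restrict (Ω : Set Plane)) :=
    (hmeas.sub_const 1).const_div 1
  have hB : ∀ᵐ x ∂(volume.restrict (Ω : Set Plane)), |alphaOf n x| ≤ B := by
    filter_upwards [hn] with x hx
    have h1 : 0 < n x - 1 := by linarith [hx.1]
    rw [alphaOf, abs_of_pos (one_div_pos.2 h1)]
    exact one_div_le_one_div_of_le (by linarith) (by linarith [hx.1])
  obtain ⟨A, hA⟩ := exists_sesquilinear_aU (𝕜 := 𝕜) hB0.le hα hB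
  have hcoer := le_re_aBlock_self (𝕜 := 𝕜) hns hα hB hn
  refine ⟨⟨A, hA, fun w w' => ?_⟩, ?_, hcoer⟩
  · rw [hA]
    exact norm_aU_le hB0.le hα hB w w'
  · exact infSup_aU_ge hB0.le hc0 hK hδ hδc hα hB (norm_sq_le_norm_sq_lap hR0.le hR) hcoer
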